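/- Let $k$ be an algebraically closed field of characteristic $p\ge 0$, let $f\in k[[X,Y]]$ be irreducible, and put $\mathcal{O}_f=k[[X,Y]]/\langle f\rangle$. Let $\overline{\mathcal{O}_f}$ be the integral closure of $\mathcal{O}_f$ in its field of fractions; it is a discrete valuation ring, and $v$ denotes its normalized valuation, with $v(0)=\infty$. Let $S(f)=\{v(h) : h\in\mathcal{O}_f,\ h\neq 0\}\subseteq\mathbb{N}$ be the semigroup of values of $f$, and let $c(f)$ be its conductor, that is, the least $\alpha\in S(f)$ such that $\alpha+\mathbb{N}\subseteq S(f)$. For $g\in\mathcal{O}_f$ with representative $G\in k[[X,Y]]$, let $[f,g]\in\mathcal{O}_f$ be the class of $f_XG_Y-f_YG_X$, which does not depend on the choice of $G$. Then, for every $g\in\mathcal{O}_f$, $$v([f,g])\ \ge\ c(f)+v(g)-1 .$$ Moreover, for every $g\neq 0$, the value $v(g)$ is finite and equality holds if and only if $p\nmid v(g)$. -/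

import Mathlib

namespace PlaneBranch

/-- The local ring `O_f = k[[X, Y]] / (f)` of the plane algebroid curve with equation `f`.
The indeterminates `X`, `Y` are the ones with indices `0`, `1`. -/
abbrev LocalRing {k : Type*} [Field k] (f : MvPowerSeries (Fin 2) k) : Type _ :=
  MvPowerSeries (Fin 2) k ⧸ Ideal.span {f}

/-- The integral closure of `O_f` in its (total) ring of fractions. It is a discrete valuation
ring when `f` is irreducible. -/
abbrev Normalization {k : Type*} [Field k] (f : MvPowerSeries (Fin 2) k) : Type _ :=
  integralClosure (LocalRing f) (FractionRing (LocalRing f))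

/-- The natural valuation `v` of the integral closure of `O_f`, restricted to `O_f`: the value of
`g` is the largest `n` such that `g` lies in the `n`-th power of the maximal ideal of the integral
closure, and it is `⊤` if there is no largest such `n`, i.e. if `g = 0`.
(The maximal ideal of a local ring is its Jacobson radical.) -/
noncomputable def val {k : Type*} [Field k] (f : MvPowerSeries (Fin 2) k)
    (g : LocalRing f) : ℕ∞ :=
  ⨆ (n : ℕ) (_ : algebraMap (LocalRing f) (Normalization f) g ∈
    Ring.jacobson (Normalization f) ^ n), (n : ℕ∞)

/-- The semigroup of values `S(f)`: all finite values of `v` on `O_f`. -/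
def valueSemigroup {k : Type*} [Field k] (f : MvPowerSeries (Fin 2) k) : Set ℕ :=
  {n | ∃ g : LocalRing f, val f g = (n : ℕ∞)}

/-- The conductor `c(f)` of the semigroup of values: the least `α ∈ S(f)` with `α + ℕ ⊆ S(f)`. -/
noncomputable def conductor {k : Type*} [Field k] (f : MvPowerSeries (Fin 2) k) : ℕ :=
  sInf {α | α ∈ valueSemigroup f ∧ ∀ n : ℕ, α + n ∈ valueSemigroup f}

/-- The class in `O_f` of the Jacobian determinant `f_X G_Y - f_Y G_X`. -/
noncomputable def bracketRep {k : Type*} [Field k] (f G : MvPowerSeries (Fin 2) k) :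
    LocalRing f :=
  Ideal.Quotient.mk (Ideal.span {f})
    (MvPowerSeries.pderiv k 0 f * MvPowerSeries.pderiv k 1 G
      - MvPowerSeries.pderiv k 1 f * MvPowerSeries.pderiv k 0 G)

/-- The class of `f_X G_Y - f_Y G_X` depends only on the class of `G` in `O_f`. -/
theorem bracketRep_congr {k : Type*} [Field k] (f G H : MvPowerSeries (Fin 2) k)
    (h : Ideal.Quotient.mk (Ideal.span {f}) G = Ideal.Quotient.mk (Ideal.span {f}) H) :
    bracketRep f G = bracketRep f H := by
  rw [Ideal.Quotient.eq, Ideal.mem_span_singleton] at h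
  obtain ⟨q, hq⟩ := h
  obtain rfl : G = H + f * q := by rw [← hq]; ring
  unfold bracketRep
  rw [Ideal.Quotient.eq, Ideal.mem_span_singleton]
  refine ⟨MvPowerSeries.pderiv k 0 f * MvPowerSeries.pderiv k 1 q
    - MvPowerSeries.pderiv k 1 f * MvPowerSeries.pderiv k 0 q, ?_⟩
  simp only [map_add, Derivation.leibniz, smul_eq_mul]
  ring

/-- The bracket `[f, g] = f_x g_y - f_y g_x` in `O_f`, for `g` in `O_f`. -/
noncomputable def bracket {k : Type*} [Field k] (f : MvPowerSeries (Fin 2) k)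
    (g : LocalRing f) : LocalRing f :=
  Quotient.liftOn' g (bracketRep f) fun G H h =>
    bracketRep_congr f G H (Quotient.sound' h)

/-- For every representative `G` of `g`, the bracket `[f, g]` is the class of
`f_X G_Y - f_Y G_X`. -/
theorem bracket_mk {k : Type*} [Field k] (f G : MvPowerSeries (Fin 2) k) :
    bracket f (Ideal.Quotient.mk (Ideal.span {f}) G) =
      Ideal.Quotient.mk (Ideal.span {f})
        (MvPowerSeries.pderiv k 0 f * MvPowerSeries.pderiv k 1 G
          - MvPowerSeries.pderiv k 1 f * MvPowerSeries.pderiv k 0 G) :=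
  rfl

end PlaneBranch

/-!
Write `A = k⟦X⟧`, `R = O_f` and let `B` be the normalization of `R`. The claim reduces to the
equation `v([f, g]) = c(f) + v(dg/dt)` for a uniformizer `t` of `B`, since `g = u t ^ n` has
`dg/dt = t ^ (n - 1) (t du/dt + n u)` (`addVal_derivation`).

After an exchange of the indeterminates, `f` is regular in `Y` and does not divide `f_Y`
(`exists_regular_separable`): otherwise both partial derivatives of the Weierstrass polynomial of
`f` would vanish and `f` would be a `p`-th power up to a unit. By Weierstrass preparation
`R = A[Y] / (W)`, and `f_Y` is `W'(y)` up to a unit (`exists_weierstrass_presentation`). As `W` is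
separable, `B` is a Dedekind domain, finite over `A`. It is local with residue field `k`, because
the Weierstrass factorization of a minimal polynomial over `A` is trivial
(`exists_constant_sub_pow_mem`), hence it is a discrete valuation ring.

By Nakayama `B = A[t]`. The minimal polynomial `m` of `t` has a partial derivative in `X` that is a
unit at `t`, so implicit differentiation defines `d/dt` on `B`, and `dX/dt` is `m'(t)` up to a unit
(`exists_derivation_uniformizer`). Comparing `conductor_mul_differentIdeal` for the two generators
`y` of `R` and `t` of `B` shows that `W'(y)` is `t ^ c m'(t)` up to a unit, where `t ^ c` generates
the conductor ideal of `R` in `B` (`exists_conductor_mul_different`); that `c` is the conductor of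
the value semigroup follows by successive approximation (`sInf_values_eq_of_conductor`).

Finally, the chain rule for `d/dt` (`derivation_comp_eq_sum`) and `f(x, y) = 0` give
`[f, g] · dX/dt = ± f_Y · dg/dt` (`associated_bracket_mul`). Here `f_Y` is `t ^ c · dX/dt` up to a
unit, and `dX/dt ≠ 0` cancels.
-/

namespace PlaneBranch

open PowerSeries IsLocalRing

/-! ### Power series in two variables as power series in one variable over `k⟦X⟧` -/

/-- The isomorphism `k⟦X₀, X₁⟧ ≃ k⟦X⟧⟦Y⟧` given by a choice `e` of which indeterminate is the
outer one: `Y` is the one with index `e.symm none`, `X` the one with index `e.symm (some ())`. -/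
noncomputable def splitEquiv (k : Type*) [Field k] (e : Fin 2 ≃ Option Unit) :
    MvPowerSeries (Fin 2) k ≃ₐ[k] PowerSeries (PowerSeries k) :=
  (MvPowerSeries.renameEquiv k e).trans (MvPowerSeries.optionEquivLeft Unit k)

section Split

variable {k : Type*} [Field k] (e : Fin 2 ≃ Option Unit)

theorem splitEquiv_X_outer :
    splitEquiv k e (MvPowerSeries.X (e.symm none)) = PowerSeries.X := by
  simp [splitEquiv, MvPowerSeries.renameEquiv]

theorem splitEquiv_X_inner :
    splitEquiv k e (MvPowerSeries.X (e.symm (some ()))) = PowerSeries.C PowerSeries.X := by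
  simp [splitEquiv, MvPowerSeries.renameEquiv]
  rfl

theorem splitEquiv_C (a : k) :
    splitEquiv k e (MvPowerSeries.C a) = PowerSeries.C (PowerSeries.C a) := by
  simp [splitEquiv, MvPowerSeries.renameEquiv]
  rfl

theorem coeff_coeff_splitEquiv (G : MvPowerSeries (Fin 2) k) (d : Fin 2 →₀ ℕ) :
    PowerSeries.coeff (d (e.symm (some ()))) (PowerSeries.coeff (d (e.symm none))
      (splitEquiv k e G)) = MvPowerSeries.coeff d G := by
  rw [PowerSeries.coeff_def (s := Finsupp.single () (d (e.symm (some ())))) (by simp)]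
  simp only [splitEquiv, AlgEquiv.trans_apply]
  rw [MvPowerSeries.coeff_coeff_optionEquivLeft]
  have : (Finsupp.single () (d (e.symm (some ())))).optionElim (d (e.symm none))
      = d.embDomain e.toEmbedding := by
    ext o
    obtain ⟨i, rfl⟩ := e.surjective o
    have h2 := Finsupp.embDomain_apply_self e.toEmbedding d i
    simp only [Equiv.coe_toEmbedding] at h2
    rw [h2]
    rcases h : e i with _ | ⟨⟩
    · obtain rfl : i = e.symm none := by simp [← h]
      simp
    · obtain rfl : i = e.symm (some ()) := by simp [← h]
      simp
  rw [this]
  exact MvPowerSeries.coeff_embDomain_rename e.toEmbedding G d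

theorem exists_exponent (a b : ℕ) :
    ∃ d : Fin 2 →₀ ℕ, d (e.symm (some ())) = a ∧ d (e.symm none) = b := by
  have h : e.symm none ≠ e.symm (some ()) := by simp
  exact ⟨Finsupp.single (e.symm (some ())) a + Finsupp.single (e.symm none) b, by simp,
    by simp⟩

theorem splitEquiv_pderiv_outer (G : MvPowerSeries (Fin 2) k) :
    splitEquiv k e (MvPowerSeries.pderiv k (e.symm none) G) =
      PowerSeries.derivative _ (splitEquiv k e G) := by
  ext b a
  obtain ⟨d, rfl, rfl⟩ := exists_exponent e a b
  rw [coeff_coeff_splitEquiv, MvPowerSeries.coeff_pderiv, PowerSeries.coeff_derivative,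
    ← coeff_coeff_splitEquiv e]
  have : ((d (e.symm none) : PowerSeries k) + 1) = PowerSeries.C ((d (e.symm none) : k) + 1) := by
    simp
  rw [this, PowerSeries.coeff_mul_C]
  simp

theorem coeff_splitEquiv_pderiv_inner (G : MvPowerSeries (Fin 2) k) (b : ℕ) :
    PowerSeries.coeff b (splitEquiv k e (MvPowerSeries.pderiv k (e.symm (some ())) G)) =
      PowerSeries.derivative _ (PowerSeries.coeff b (splitEquiv k e G)) := by
  ext a
  obtain ⟨d, rfl, rfl⟩ := exists_exponent e a b
  rw [coeff_coeff_splitEquiv, MvPowerSeries.coeff_pderiv, PowerSeries.coeff_derivative,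
    ← coeff_coeff_splitEquiv e]
  simp

instance : UniqueFactorizationMonoid (MvPowerSeries (Fin 2) k) :=
  (splitEquiv k ((finSuccEquiv 1).trans
    (Equiv.optionCongr (Equiv.ofUnique (Fin 1) Unit)))).symm.toMulEquiv.uniqueFactorizationMonoid
      inferInstance

end Split

/-! ### Perfect powers -/

/-- Over a perfect field of characteristic `p`, a power series all of whose partial derivatives
vanish is a `p`-th power. -/
theorem exists_pow_eq_of_pderiv_eq_zero {σ k : Type*} [Finite σ] [Field k] (p : ℕ)
    [Fact p.Prime] [CharP k p] [PerfectRing k p] (F : MvPowerSeries σ k)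
    (hF : ∀ i, MvPowerSeries.pderiv k i F = 0) : ∃ V, V ^ p = F := by
  have hp : p ≠ 0 := (Fact.out : p.Prime).ne_zero
  let V : MvPowerSeries σ k := fun d => (frobeniusEquiv k p).symm (MvPowerSeries.coeff (p • d) F)
  refine ⟨V, ?_⟩
  rw [← MvPowerSeries.map_frobenius_expand p hp]
  ext d
  rw [MvPowerSeries.coeff_map]
  by_cases hd : ∀ i, p ∣ d i
  · obtain ⟨d', rfl⟩ : ∃ d', d = p • d' := by
      refine ⟨d.mapRange (· / p) (by simp), ?_⟩
      ext i
      simp [Nat.mul_div_cancel' (hd i)]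
    rw [MvPowerSeries.coeff_expand_smul]
    exact (frobeniusEquiv k p).apply_symm_apply _
  · push Not at hd
    obtain ⟨i, hi⟩ := hd
    rw [MvPowerSeries.coeff_expand_of_not_dvd p hp _ hi, map_zero]
    have h1 : 1 ≤ d i := Nat.one_le_iff_ne_zero.2 fun h => hi (h ▸ dvd_zero p)
    have h := MvPowerSeries.coeff_pderiv (i := i) F (d - Finsupp.single i 1)
    rw [hF i, map_zero, tsub_add_cancel_of_le (by simpa using h1)] at h
    have h3 : (((d - Finsupp.single i 1 : σ →₀ ℕ) i : ℕ) : k) + 1 = (d i : k) := by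
      have : (d - Finsupp.single i 1 : σ →₀ ℕ) i + 1 = d i := by simp; omega
      exact_mod_cast congrArg (Nat.cast : ℕ → k) this
    rw [h3] at h
    have h4 : (d i : k) ≠ 0 := fun h0 => hi ((CharP.cast_eq_zero_iff k p _).1 h0)
    exact ((mul_eq_zero.1 h.symm).resolve_right h4).symm

/-! ### Weierstrass polynomials -/

instance (k : Type*) [Field k] : IsAdicComplete (maximalIdeal k⟦X⟧) k⟦X⟧ := by
  rw [PowerSeries.maximalIdeal_eq_span_X]
  infer_instance

/-- A polynomial divisible by a distinguished polynomial as a power series is divisible by it as a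
polynomial. -/
theorem _root_.Polynomial.IsDistinguishedAt.dvd_of_coe_dvd {A : Type*} [CommRing A] {I : Ideal A}
    [IsAdicComplete I A] {W Q : Polynomial A} (hW : W.IsDistinguishedAt I)
    (h : (W : A⟦X⟧) ∣ Q) : W ∣ Q := by
  rw [← Ideal.mem_span_singleton, ← Ideal.Quotient.eq_zero_iff_mem] at h ⊢
  apply hW.algEquivQuotient.injective
  rw [map_zero, ← h]
  rfl

theorem _root_.Polynomial.IsDistinguishedAt.eq_zero_of_coe_dvd {A : Type*} [CommRing A]
    {I : Ideal A} [IsAdicComplete I A] {W Q : Polynomial A} (hW : W.IsDistinguishedAt I)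
    (h : (W : A⟦X⟧) ∣ Q) (hdeg : Q.degree < W.degree) : Q = 0 := by
  by_contra h0
  obtain ⟨q, rfl⟩ := hW.dvd_of_coe_dvd h
  exact (hW.monic.not_dvd_of_degree_lt h0 hdeg) (dvd_mul_right _ _)

section Regular

variable {k : Type*} [Field k]

/-- A power series in `Y` over `k⟦X⟧` whose reduction modulo `X` vanishes is divisible by `X`. -/
theorem C_X_dvd_of_map_residue_eq_zero {F : PowerSeries (PowerSeries k)}
    (h : F.map (residue (PowerSeries k)) = 0) : PowerSeries.C PowerSeries.X ∣ F := by
  have h1 : ∀ n, ∃ a, PowerSeries.coeff n F = PowerSeries.X * a := by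
    intro n
    have h2 := congrArg (PowerSeries.coeff n) h
    rw [PowerSeries.coeff_map, map_zero, residue_eq_zero_iff, PowerSeries.maximalIdeal_eq_span_X,
      Ideal.mem_span_singleton] at h2
    exact h2
  choose a ha using h1
  exact ⟨PowerSeries.mk a, by ext1 n; rw [ha, PowerSeries.coeff_C_mul, PowerSeries.coeff_mk]⟩

/-- An irreducible `f` has, in one of the two directions, a nonvanishing restriction to the
coordinate axis and a partial derivative that is not divisible by `f`. If both partial derivatives
were divisible by `f`, those of its Weierstrass polynomial would vanish, so the latter would be a
constant or a `p`-th power. -/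
theorem exists_regular_separable [IsAlgClosed k] {f : MvPowerSeries (Fin 2) k}
    (hf : Irreducible f) : ∃ e : Fin 2 ≃ Option Unit,
      (splitEquiv k e f).map (residue (PowerSeries k)) ≠ 0 ∧
        ¬ f ∣ MvPowerSeries.pderiv k (e.symm none) f := by
  -- `key` treats an `e` for which the restriction vanishes: then `f` is the
  -- inner indeterminate up to a unit, and `e'` makes that one the outer indeterminate.
  have key : ∀ e e' : Fin 2 ≃ Option Unit, e'.symm none = e.symm (some ()) →
      (splitEquiv k e f).map (residue (PowerSeries k)) = 0 →
      (splitEquiv k e' f).map (residue (PowerSeries k)) ≠ 0 ∧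
        ¬ f ∣ MvPowerSeries.pderiv k (e'.symm none) f := by
    intro e e' hee h0
    have h1 : MvPowerSeries.X (e.symm (some ())) ∣ f := by
      rw [← map_dvd_iff (splitEquiv k e), splitEquiv_X_inner]
      exact C_X_dvd_of_map_residue_eq_zero h0
    rw [← hee] at h1
    have hX : ¬ IsUnit (MvPowerSeries.X (e'.symm none) : MvPowerSeries (Fin 2) k) := by
      rw [MvPowerSeries.isUnit_iff_constantCoeff]
      simp
    obtain ⟨u, hu⟩ := h1
    have hunit : IsUnit u := (hf.isUnit_or_isUnit hu).resolve_left hX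
    constructor
    · rw [hu, map_mul, splitEquiv_X_outer, map_mul, PowerSeries.map_X]
      exact mul_ne_zero PowerSeries.X_ne_zero ((hunit.map _).map _).ne_zero
    · intro hd
      apply hX
      refine isUnit_of_dvd_unit ?_ hunit
      have h2 : MvPowerSeries.X (e'.symm none) ∣ MvPowerSeries.pderiv k (e'.symm none) f :=
        (Dvd.intro _ hu.symm).trans hd
      rw [hu, Derivation.leibniz, MvPowerSeries.pderiv_X_self, smul_eq_mul, smul_eq_mul,
        mul_one] at h2
      exact (dvd_add_right (dvd_mul_right _ _)).1 h2
  by_contra! hcon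
  let e : Fin 2 ≃ Option Unit := (finSuccEquiv 1).trans
    (Equiv.optionCongr (Equiv.ofUnique (Fin 1) Unit))
  let e' : Fin 2 ≃ Option Unit := (Equiv.swap 0 1).trans e
  have h1 : e'.symm none = e.symm (some ()) := by decide
  have h2 : e.symm none = e'.symm (some ()) := by decide
  have r1 : (splitEquiv k e f).map (residue (PowerSeries k)) ≠ 0 := fun h =>
    (key e e' h1 h).2 (hcon e' (key e e' h1 h).1)
  have r2 : (splitEquiv k e' f).map (residue (PowerSeries k)) ≠ 0 := fun h =>
    (key e' e h2 h).2 (hcon e (key e' e h2 h).1)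
  have d1 := hcon e r1
  have d2 := hcon e' r2
  rw [h1] at d2
  obtain ⟨W, u, hW⟩ := PowerSeries.exists_isWeierstrassFactorization r1
  set F := (splitEquiv k e).symm W with hF
  have hassoc : Associated f F := by
    have : Associated (splitEquiv k e f) (W : PowerSeries (PowerSeries k)) := by
      rw [hW.eq_mul]
      exact (associated_mul_unit_left _ _ hW.isUnit)
    have h3 := this.map (splitEquiv k e).symm
    simpa using h3
  have hEF : splitEquiv k e F = W := by simp [hF]
  have dF : ∀ i, f ∣ MvPowerSeries.pderiv k i f → F ∣ MvPowerSeries.pderiv k i F := by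
    intro i hi
    obtain ⟨v, hv⟩ := hassoc
    rw [← hv, Derivation.leibniz, smul_eq_mul, smul_eq_mul, hv, ← hv]
    refine dvd_add ((v.isUnit.mul_right_dvd).2 (dvd_mul_right _ _))
      ((v.isUnit.mul_right_dvd).2 (hi.mul_left _))
  have hWdeg : 0 < W.natDegree := by
    by_contra! h0
    have : W = 1 := by
      exact Polynomial.eq_one_of_monic_natDegree_zero hW.isDistinguishedAt.monic (by omega)
    apply hf.not_isUnit
    rw [hassoc.isUnit_iff, hF, this]
    simp
  have hW1 : Polynomial.derivative W = 0 := by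
    apply hW.isDistinguishedAt.eq_zero_of_coe_dvd
    · have := (map_dvd_iff (splitEquiv k e)).2 (dF _ d1)
      rwa [splitEquiv_pderiv_outer, hEF, PowerSeries.derivative_coe] at this
    · exact Polynomial.degree_derivative_lt hW.isDistinguishedAt.monic.ne_zero
  have z1 : MvPowerSeries.pderiv k (e.symm none) F = 0 := by
    apply (splitEquiv k e).injective
    rw [splitEquiv_pderiv_outer, hEF, PowerSeries.derivative_coe, hW1]
    simp
  have z2 : MvPowerSeries.pderiv k (e.symm (some ())) F = 0 := by
    apply (splitEquiv k e).injective
    -- `Q` is `W` with its coefficients differentiated: the leading one, `1`, disappears.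
    let Q : Polynomial (PowerSeries k) := ∑ i ∈ Finset.range W.natDegree,
      Polynomial.monomial i (PowerSeries.derivative k (W.coeff i))
    have hQ : splitEquiv k e (MvPowerSeries.pderiv k (e.symm (some ())) F) = Q := by
      ext1 b
      rw [coeff_splitEquiv_pderiv_inner, hEF]
      simp only [Polynomial.coeff_coe, Q, Polynomial.finsetSum_coeff, Polynomial.coeff_monomial]
      rw [Finset.sum_ite_eq']
      split_ifs with hb
      · rfl
      · rw [Finset.mem_range, not_lt] at hb
        rcases hb.eq_or_lt with rfl | hb
        · rw [hW.isDistinguishedAt.monic.coeff_natDegree, Derivation.map_one_eq_zero]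
        · rw [Polynomial.coeff_eq_zero_of_natDegree_lt hb, map_zero]
    rw [hQ, map_zero]
    have : Q = 0 := by
      apply hW.isDistinguishedAt.eq_zero_of_coe_dvd
      · have := (map_dvd_iff (splitEquiv k e)).2 (dF _ d2)
        rwa [hQ, hEF] at this
      · rw [Polynomial.degree_eq_natDegree hW.isDistinguishedAt.monic.ne_zero]
        refine lt_of_le_of_lt (Polynomial.degree_sum_le _ _) ?_
        rw [Finset.sup_lt_iff (WithBot.bot_lt_coe _)]
        intro i hi
        exact (Polynomial.degree_monomial_le _ _).trans_lt
          (by exact_mod_cast Finset.mem_range.1 hi)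
    rw [this, Polynomial.coe_zero]
  obtain ⟨p, hp⟩ := CharP.exists k
  rcases CharP.char_is_prime_or_zero k p with hpp | rfl
  · have : Fact p.Prime := ⟨hpp⟩
    obtain ⟨V, hV⟩ := exists_pow_eq_of_pderiv_eq_zero p F (by
      intro i
      obtain ⟨o, rfl⟩ := e.symm.surjective i
      rcases o with _ | ⟨⟩
      exacts [z1, z2])
    have hirr : Irreducible F := hassoc.irreducible hf
    rw [← hV] at hirr
    exact not_irreducible_pow hpp.one_lt.ne' hirr
  · have : CharZero k := CharP.charP_to_charZero k
    have : CharZero (PowerSeries k) := charZero_of_injective_algebraMap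
      (PowerSeries.C_injective (R := k))
    have := Polynomial.derivative_eq_zero.1 hW1
    omega

/-- The structure map `k⟦X⟧ → O_f`, where `X` is the inner indeterminate with respect to `e`. -/
noncomputable def innerMap (e : Fin 2 ≃ Option Unit) (f : MvPowerSeries (Fin 2) k) :
    PowerSeries k →+* LocalRing f :=
  (Ideal.Quotient.mk (Ideal.span {f})).comp
    (((splitEquiv k e).symm : _ →+* MvPowerSeries (Fin 2) k).comp PowerSeries.C)

/-- The class in `O_f` of the outer indeterminate with respect to `e`. -/
noncomputable def outerVar (e : Fin 2 ≃ Option Unit) (f : MvPowerSeries (Fin 2) k) : LocalRing f :=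
  Ideal.Quotient.mk (Ideal.span {f}) (MvPowerSeries.X (e.symm none))

theorem innerMap_X (e : Fin 2 ≃ Option Unit) (f : MvPowerSeries (Fin 2) k) :
    innerMap e f PowerSeries.X =
      Ideal.Quotient.mk (Ideal.span {f}) (MvPowerSeries.X (e.symm (some ()))) := by
  simp [innerMap, ← splitEquiv_X_inner e]

theorem innerMap_C (e : Fin 2 ≃ Option Unit) (f : MvPowerSeries (Fin 2) k) (a : k) :
    innerMap e f (PowerSeries.C a) = Ideal.Quotient.mk (Ideal.span {f}) (MvPowerSeries.C a) := by
  simp [innerMap, ← splitEquiv_C e]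

theorem eval₂_innerMap (e : Fin 2 ≃ Option Unit) (f : MvPowerSeries (Fin 2) k)
    (Q : Polynomial (PowerSeries k)) : Q.eval₂ (innerMap e f) (outerVar e f) =
      Ideal.Quotient.mk (Ideal.span {f}) ((splitEquiv k e).symm (Q : PowerSeries (PowerSeries k)))
    := by
  have : Polynomial.eval₂RingHom (innerMap e f) (outerVar e f) =
      ((Ideal.Quotient.mk (Ideal.span {f})).comp
        ((splitEquiv k e).symm : _ →+* MvPowerSeries (Fin 2) k)).comp
        Polynomial.coeToPowerSeries.ringHom := by
    apply Polynomial.ringHom_ext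
    · intro a
      simp [innerMap]
    · simp [outerVar, ← splitEquiv_X_outer e]
  exact congrArg (fun φ => φ Q) this

theorem derivative_mul {R : Type*} [CommRing R] (F G : R⟦X⟧) :
    PowerSeries.derivative R (F * G) =
      F * PowerSeries.derivative R G + G * PowerSeries.derivative R F := by
  simp

/-- If `f` is regular with respect to the outer indeterminate `Y`, then `O_f` is `k⟦X⟧[Y]` modulo
the Weierstrass polynomial `W` of `f`, and `f_Y` is `W'` up to a unit of `O_f`. -/
theorem exists_weierstrass_presentation {f : MvPowerSeries (Fin 2) k} (e : Fin 2 ≃ Option Unit)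
    (hr : (splitEquiv k e f).map (residue (PowerSeries k)) ≠ 0) :
    ∃ W : Polynomial (PowerSeries k), W.Monic ∧
      (∀ r, ∃ Q : Polynomial (PowerSeries k), Q.eval₂ (innerMap e f) (outerVar e f) = r) ∧
      (∀ Q : Polynomial (PowerSeries k), Q.eval₂ (innerMap e f) (outerVar e f) = 0 ↔ W ∣ Q) ∧
      ∃ u : LocalRing f, IsUnit u ∧
        Ideal.Quotient.mk (Ideal.span {f}) (MvPowerSeries.pderiv k (e.symm none) f) =
          u * W.derivative.eval₂ (innerMap e f) (outerVar e f) := by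
  obtain ⟨W, u, hW⟩ := PowerSeries.exists_isWeierstrassFactorization hr
  have hassoc : Associated (splitEquiv k e f) (W : PowerSeries (PowerSeries k)) := by
    rw [hW.eq_mul]
    exact associated_mul_unit_left _ _ hW.isUnit
  refine ⟨W, hW.isDistinguishedAt.monic, ?_, ?_, ?_⟩
  · intro r
    obtain ⟨G, rfl⟩ := Ideal.Quotient.mk_surjective r
    obtain ⟨q, Q, -, hQ⟩ := PowerSeries.exists_isWeierstrassDivision (splitEquiv k e G) hr
    refine ⟨Q, ?_⟩
    rw [eval₂_innerMap, eq_comm, Ideal.Quotient.eq, Ideal.mem_span_singleton,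
      ← map_dvd_iff (splitEquiv k e), map_sub, AlgEquiv.apply_symm_apply, hQ]
    simp
  · intro Q
    rw [eval₂_innerMap, Ideal.Quotient.eq_zero_iff_mem, Ideal.mem_span_singleton,
      ← map_dvd_iff (splitEquiv k e), AlgEquiv.apply_symm_apply, hassoc.dvd_iff_dvd_left]
    refine ⟨hW.isDistinguishedAt.dvd_of_coe_dvd, ?_⟩
    rintro ⟨q, rfl⟩
    simp
  · refine ⟨Ideal.Quotient.mk _ ((splitEquiv k e).symm u), (hW.isUnit.map _).map _, ?_⟩
    rw [eval₂_innerMap, ← map_mul, Ideal.Quotient.eq, Ideal.mem_span_singleton,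
      ← map_dvd_iff (splitEquiv k e), map_sub, splitEquiv_pderiv_outer, map_mul,
      AlgEquiv.apply_symm_apply, AlgEquiv.apply_symm_apply, hassoc.dvd_iff_dvd_left]
    rw [hW.eq_mul, derivative_mul, PowerSeries.derivative_coe, mul_comm u, add_sub_cancel_right]
    exact dvd_mul_right _ _

end Regular

/-! ### Finite extensions of `k⟦X⟧` -/

section Finite

variable {k : Type*} [Field k] {B : Type*} [CommRing B] [Algebra k⟦X⟧ B]

/-- An irreducible monic polynomial over `k⟦X⟧` whose constant coefficient is not a unit is
distinguished, since it is associated to its Weierstrass polynomial. -/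
theorem isDistinguishedAt_of_irreducible {h : Polynomial k⟦X⟧} (hm : h.Monic)
    (hirr : Irreducible h) (h0 : h.coeff 0 ∈ maximalIdeal k⟦X⟧) :
    h.IsDistinguishedAt (maximalIdeal k⟦X⟧) := by
  have hne : (h : PowerSeries k⟦X⟧).map (residue k⟦X⟧) ≠ 0 := by
    intro hz
    have := congrArg (PowerSeries.coeff h.natDegree) hz
    simp [hm] at this
  obtain ⟨W, u, hW⟩ := PowerSeries.exists_isWeierstrassFactorization hne
  obtain ⟨q, hq⟩ := hW.isDistinguishedAt.dvd_of_coe_dvd (Dvd.intro _ hW.eq_mul.symm)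
  have hWunit : ¬ IsUnit W := by
    intro hu
    have h1 := hW.eq_mul
    rw [hW.isDistinguishedAt.monic.eq_one_of_isUnit hu, Polynomial.coe_one, one_mul] at h1
    have h2 := hW.isUnit
    rw [← h1, PowerSeries.isUnit_iff_constantCoeff] at h2
    exact (mem_maximalIdeal _).1 h0 (by simpa using h2)
  have hqu := (hirr.isUnit_or_isUnit hq).resolve_left hWunit
  have : h = W := Polynomial.eq_of_monic_of_associated hm hW.isDistinguishedAt.monic
    (by rw [hq]; exact associated_mul_unit_left _ _ hqu)
  rw [this]
  exact hW.isDistinguishedAt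

theorem pow_mem_span_X_of_isDistinguishedAt {h : Polynomial k⟦X⟧}
    (hd : h.IsDistinguishedAt (maximalIdeal k⟦X⟧)) {b : B} (hb : Polynomial.aeval b h = 0) :
    ∃ n, b ^ n ∈ Ideal.span {algebraMap k⟦X⟧ B PowerSeries.X} := by
  have hw := hd.toIsWeaklyEisensteinAt
  rw [PowerSeries.maximalIdeal_eq_span_X] at hw
  obtain ⟨y, -, hy⟩ := hw.exists_mem_adjoin_mul_eq_pow_natDegree hb hd.monic
  exact ⟨_, hy ▸ Ideal.mul_mem_right _ _ (Ideal.mem_span_singleton_self _)⟩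

/-- Over an algebraically closed field, every integral element over `k⟦X⟧` differs from a constant
by an element that is nilpotent modulo `X`: this is Hensel's lemma for its minimal polynomial. -/
theorem exists_constant_sub_pow_mem [IsAlgClosed k] [IsDomain B] {b : B} (hb : IsIntegral k⟦X⟧ b) :
    ∃ (a : k) (n : ℕ), (b - algebraMap k⟦X⟧ B (PowerSeries.C a)) ^ n ∈
      Ideal.span {algebraMap k⟦X⟧ B PowerSeries.X} := by
  have hm := minpoly.monic hb
  obtain ⟨a, ha⟩ := IsAlgClosed.exists_root ((minpoly k⟦X⟧ b).map PowerSeries.constantCoeff) (by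
    rw [hm.degree_map]
    exact (minpoly.degree_pos hb).ne')
  refine ⟨a, ?_⟩
  have hirr : Irreducible (Polynomial.taylor (PowerSeries.C a) (minpoly k⟦X⟧ b)) :=
    (MulEquiv.irreducible_iff (Polynomial.taylorEquiv (PowerSeries.C a))).2
      (minpoly.irreducible hb)
  refine pow_mem_span_X_of_isDistinguishedAt
    (isDistinguishedAt_of_irreducible ?_ hirr ?_) ?_
  · rw [Polynomial.Monic, Polynomial.leadingCoeff_taylor]
    exact hm
  · rw [Polynomial.taylor_coeff_zero, PowerSeries.maximalIdeal_eq_span_X,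
      Ideal.mem_span_singleton, PowerSeries.X_dvd_iff]
    rw [Polynomial.IsRoot, Polynomial.eval_map] at ha
    rw [← ha, ← Polynomial.eval₂_at_apply]
    simp
  · rw [Polynomial.taylor_apply, Polynomial.aeval_comp]
    simp

theorem span_X_le_ringJacobson [Algebra.IsIntegral k⟦X⟧ B] :
    Ideal.span {algebraMap k⟦X⟧ B PowerSeries.X} ≤ Ring.jacobson B := by
  rw [Ideal.span_singleton_le_iff_mem, Ring.jacobson_eq_sInf_isMaximal, Ideal.mem_sInf]
  intro M hM
  have hM : M.IsMaximal := hM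
  have h1 := Ideal.isMaximal_comap_of_isIntegral_of_isMaximal (R := k⟦X⟧) M
  have h2 := IsLocalRing.eq_maximalIdeal h1
  have h3 : (PowerSeries.X : k⟦X⟧) ∈ M.comap (algebraMap k⟦X⟧ B) := by
    rw [h2, PowerSeries.maximalIdeal_eq_span_X]
    exact Ideal.mem_span_singleton_self _
  exact h3

theorem exists_constant_sub_mem_ringJacobson [IsAlgClosed k] [IsDomain B]
    [Algebra.IsIntegral k⟦X⟧ B] (b : B) :
    ∃ a : k, b - algebraMap k⟦X⟧ B (PowerSeries.C a) ∈ Ring.jacobson B := by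
  obtain ⟨a, n, h⟩ := exists_constant_sub_pow_mem (Algebra.IsIntegral.isIntegral (R := k⟦X⟧) b)
  refine ⟨a, ?_⟩
  have h1 := span_X_le_ringJacobson h
  rw [← Ideal.jacobson_bot] at h1 ⊢
  exact Ideal.isRadical_jacobson _ ⟨n, h1⟩

/-- A domain that is integral over `k⟦X⟧`, with `k` algebraically closed, is local. -/
theorem isLocalRing_of_isIntegral [IsAlgClosed k] [IsDomain B] [Algebra.IsIntegral k⟦X⟧ B] :
    IsLocalRing B := by
  -- An element congruent to a nonzero constant modulo the Jacobson radical is a unit.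
  have key : ∀ b : B, b ∈ Ring.jacobson B ∨ IsUnit b := by
    intro b
    obtain ⟨a, ha⟩ := exists_constant_sub_mem_ringJacobson (k := k) b
    by_cases h0 : a = 0
    · left
      simpa [h0] using ha
    · right
      have hc : IsUnit (algebraMap k⟦X⟧ B (PowerSeries.C a)) :=
        ((Ne.isUnit h0).map PowerSeries.C).map _
      obtain ⟨v, hv⟩ := hc
      rw [← Ideal.jacobson_bot, Ideal.mem_jacobson_bot] at ha
      have h2 := ha (↑v⁻¹ : B)
      rw [← hv, sub_mul, Units.mul_inv, sub_add_cancel] at h2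
      exact isUnit_of_mul_isUnit_left h2
  refine IsLocalRing.of_isUnit_or_isUnit_one_sub_self fun b => ?_
  rcases key b with hb | hb
  · right
    rw [← Ideal.jacobson_bot, Ideal.mem_jacobson_bot] at hb
    have := hb (-1)
    rwa [mul_neg, mul_one, neg_add_eq_sub] at this
  · exact Or.inl hb

/-- The normalization of a finite extension of `k⟦X⟧` is a discrete valuation ring. -/
theorem isDiscreteValuationRing_of_isDedekindDomain [IsAlgClosed k] [Algebra.IsIntegral k⟦X⟧ B]
    [IsDedekindDomain B] [FaithfulSMul k⟦X⟧ B] : IsDiscreteValuationRing B := by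
  have := isLocalRing_of_isIntegral (k := k) (B := B)
  have hf : ¬ IsField B := by
    rw [← Algebra.IsIntegral.isField_iff_isField (FaithfulSMul.algebraMap_injective k⟦X⟧ B)]
    exact IsDiscreteValuationRing.not_isField k⟦X⟧
  have h : IsDiscreteValuationRing B ↔ IsDedekindDomain B :=
    (IsDiscreteValuationRing.TFAE B hf).out 0 2
  exact h.2 inferInstance

end Finite

/-! ### Uniformizers and derivations -/

section Uniformizer

variable {k : Type*} [Field k] {B : Type*} [CommRing B] [IsDomain B] [Algebra k⟦X⟧ B]
  [IsDiscreteValuationRing B] {t : B}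

theorem exists_constant_sub_dvd [IsAlgClosed k] [Algebra.IsIntegral k⟦X⟧ B] (ht : Irreducible t)
    (b : B) : ∃ a : k, t ∣ b - algebraMap k⟦X⟧ B (PowerSeries.C a) := by
  obtain ⟨a, ha⟩ := exists_constant_sub_mem_ringJacobson (k := k) b
  rw [IsLocalRing.ringJacobson_eq_maximalIdeal,
    (IsDiscreteValuationRing.irreducible_iff_uniformizer t).1 ht, Ideal.mem_span_singleton] at ha
  exact ⟨a, ha⟩

theorem uniformizer_dvd_X [Algebra.IsIntegral k⟦X⟧ B] (ht : Irreducible t) :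
    t ∣ algebraMap k⟦X⟧ B PowerSeries.X := by
  have h := span_X_le_ringJacobson (k := k) (B := B)
  rwa [IsLocalRing.ringJacobson_eq_maximalIdeal,
    (IsDiscreteValuationRing.irreducible_iff_uniformizer t).1 ht,
    Ideal.span_singleton_le_span_singleton] at h

theorem exists_degree_lt_pow_dvd_sub [IsAlgClosed k] [Algebra.IsIntegral k⟦X⟧ B]
    (ht : Irreducible t) (n : ℕ) (b : B) :
    ∃ P : Polynomial k⟦X⟧, P.degree < n ∧ t ^ n ∣ b - Polynomial.aeval t P := by
  induction n with
  | zero => exact ⟨0, by simp⟩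
  | succ n ih =>
    obtain ⟨P, hP, c, hc⟩ := ih
    obtain ⟨a, d, hd⟩ := exists_constant_sub_dvd (k := k) ht c
    refine ⟨P + Polynomial.monomial n (PowerSeries.C a), ?_, d, ?_⟩
    · refine lt_of_le_of_lt (Polynomial.degree_add_le _ _) (max_lt ?_ ?_)
      · exact hP.trans (by exact_mod_cast Nat.lt_succ_self n)
      · exact (Polynomial.degree_monomial_le _ _).trans_lt (by exact_mod_cast Nat.lt_succ_self n)
    · rw [map_add, Polynomial.aeval_monomial]
      linear_combination hc + t ^ n * hd

/-- If `X` has value `e` in `B`, then `1, t, …, t ^ (e - 1)` generate `B` over `k⟦X⟧`, by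
Nakayama's lemma. -/
theorem exists_aeval_uniformizer_eq [IsAlgClosed k] [Module.Finite k⟦X⟧ B] (ht : Irreducible t)
    {e : ℕ} {u : Bˣ} (hX : algebraMap k⟦X⟧ B PowerSeries.X = u * t ^ e) (b : B) :
    ∃ P : Polynomial k⟦X⟧, P.degree < e ∧ Polynomial.aeval t P = b := by
  let N : Submodule k⟦X⟧ B :=
    (Polynomial.degreeLT k⟦X⟧ e).map (Polynomial.aeval (R := k⟦X⟧) t).toLinearMap
  have h : (⊤ : Submodule k⟦X⟧ B) ≤ N := by
    apply Submodule.le_of_le_smul_of_le_jacobson_bot (I := maximalIdeal k⟦X⟧) Module.Finite.fg_top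
    · rw [IsLocalRing.jacobson_eq_maximalIdeal _ bot_ne_top]
    · intro b _
      obtain ⟨P, hP, c, hc⟩ := exists_degree_lt_pow_dvd_sub (k := k) ht e b
      have h1 : b = Polynomial.aeval t P + (PowerSeries.X : k⟦X⟧) • ((↑u⁻¹ : B) * c) := by
        rw [Algebra.smul_def, hX]
        linear_combination hc - t ^ e * c * u.mul_inv
      rw [h1]
      refine Submodule.add_mem_sup ⟨P, Polynomial.mem_degreeLT.2 hP, rfl⟩
        (Submodule.smul_mem_smul ?_ trivial)
      rw [PowerSeries.maximalIdeal_eq_span_X]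
      exact Ideal.mem_span_singleton_self _
  obtain ⟨P, hP, hPb⟩ := h (trivial : b ∈ ⊤)
  exact ⟨P, Polynomial.mem_degreeLT.1 hP, hPb⟩

theorem adjoin_uniformizer_eq_top [IsAlgClosed k] [Module.Finite k⟦X⟧ B] [FaithfulSMul k⟦X⟧ B]
    (ht : Irreducible t) : Algebra.adjoin k⟦X⟧ {t} = ⊤ := by
  obtain ⟨e, u, hX⟩ := IsDiscreteValuationRing.eq_unit_mul_pow_irreducible
    ((map_ne_zero_iff _ (FaithfulSMul.algebraMap_injective k⟦X⟧ B)).2 PowerSeries.X_ne_zero) ht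
  rw [eq_top_iff]
  intro b _
  obtain ⟨P, -, rfl⟩ := exists_aeval_uniformizer_eq ht hX b
  exact Polynomial.aeval_mem_adjoin_singleton _ _

end Uniformizer

section ImplicitDifferentiation

variable {A : Type*} [CommRing A] [Differential A] {B : Type*} [CommRing B] [Algebra A B] {t : B}

/-- Implicit differentiation: if `B = A[T] / (m)`, then `d/dT` extends to a derivation of `B` that
is a multiple of the given derivation on `A`, as soon as the polynomial obtained from `m` by
differentiating the coefficients takes a unit as value at the class `t` of `T`. -/
theorem exists_derivation (hsurj : Function.Surjective (Polynomial.aeval (R := A) t))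
    {m : Polynomial A} (hker : ∀ P, Polynomial.aeval t P = 0 ↔ m ∣ P)
    (hunit : IsUnit (Polynomial.aeval t (Differential.mapCoeffs m))) :
    ∃ (D : Derivation ℤ B B) (ξ : B), D t = 1 ∧
      (∀ a : A, D (algebraMap A B a) = ξ * algebraMap A B (Differential.deriv a)) ∧
      Associated ξ (Polynomial.aeval t (Polynomial.derivative m)) := by
  obtain ⟨v, hv⟩ := hunit
  obtain ⟨ξ, hξ⟩ := hsurj (-(↑v⁻¹ : B) * Polynomial.aeval t (Polynomial.derivative m))
  let φ : Polynomial A →ₐ[ℤ] B := (Polynomial.aeval (R := A) t).restrictScalars ℤ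
  have hφ : ∀ P, φ P = Polynomial.aeval t P := fun P => rfl
  let d : Derivation ℤ (Polynomial A) (Polynomial A) :=
    ξ • Differential.mapCoeffs + Polynomial.derivative'.restrictScalars ℤ
  have hd : ∀ P, d P = ξ * Differential.mapCoeffs P + Polynomial.derivative P := fun P => rfl
  have hm : φ m = 0 := (hker m).2 dvd_rfl
  have hdm : φ (d m) = 0 := by
    rw [hd, hφ, map_add, map_mul, hξ, ← hv]
    linear_combination (-Polynomial.aeval t (Polynomial.derivative m)) * v.inv_mul
  have hd0 : ∀ P, φ P = 0 → φ (d P) = 0 := by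
    intro P hP
    obtain ⟨Q, rfl⟩ := (hker P).1 hP
    rw [Derivation.leibniz, map_add, smul_eq_mul, smul_eq_mul, map_mul, map_mul, hdm, hm]
    simp
  have hsurj' : Function.Surjective φ := hsurj
  refine ⟨Derivation.liftOfSurjective hsurj' hd0, Polynomial.aeval t ξ, ?_, ?_, ?_⟩
  · have h := Derivation.liftOfSurjective_apply hsurj' hd0 Polynomial.X
    rw [hφ, Polynomial.aeval_X] at h
    rw [h, hd]
    simp
  · intro a
    have h := Derivation.liftOfSurjective_apply hsurj' hd0 (Polynomial.C a)
    rw [hφ, Polynomial.aeval_C] at h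
    rw [h, hd, hφ]
    simp
  · rw [hξ]
    exact associated_unit_mul_left _ _ (v⁻¹.isUnit.neg)

theorem mapCoeffs_X_pow_add_C_mul (n : ℕ) (x : A) (Q : Polynomial A) :
    Differential.mapCoeffs (Polynomial.X ^ n + Polynomial.C x * Q) =
      Polynomial.C (Differential.deriv x) * Q + Polynomial.C x * Differential.mapCoeffs Q := by
  rw [map_add, Derivation.leibniz, Derivation.leibniz_pow, Differential.mapCoeffs_X,
    Differential.mapCoeffs_C]
  simp only [smul_eq_mul, mul_zero, smul_zero, zero_add]
  ring

end ImplicitDifferentiation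

/-- An additive map satisfying the Leibniz rule makes a ring a differential ring. -/
@[reducible] def differentialOfLeibniz {A : Type*} [CommRing A] (d : A →+ A)
    (h : ∀ a b, d (a * b) = a * d b + b * d a) : Differential A :=
  ⟨Derivation.mk' d.toIntLinearMap h⟩

/-- Formal differentiation makes `k⟦X⟧` a differential ring. -/
@[reducible] noncomputable def differentialPowerSeries (k : Type*) [Field k] :
    Differential k⟦X⟧ :=
  differentialOfLeibniz (PowerSeries.derivative k).toLinearMap.toAddMonoidHom derivative_mul

section Derivation

attribute [local instance] differentialPowerSeries

theorem deriv_powerSeries {k : Type*} [Field k] (a : k⟦X⟧) :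
    Differential.deriv a = PowerSeries.derivative k a := rfl

variable {k : Type*} [Field k] {B : Type*} [CommRing B] [Algebra k⟦X⟧ B] {t : B}

variable [IsDomain B] [IsDiscreteValuationRing B]

/-- The minimal polynomial `m` of a uniformizer over `k⟦X⟧` is of the form `T ^ n + X * Q(T)` where
`Q(t)` is a unit, hence so is the value at `t` of its derivative with respect to `X`. -/
theorem isUnit_aeval_mapCoeffs_minpoly [IsAlgClosed k] [Module.Finite k⟦X⟧ B]
    [FaithfulSMul k⟦X⟧ B] (ht : Irreducible t) :
    IsUnit (Polynomial.aeval t (Differential.mapCoeffs (minpoly k⟦X⟧ t))) := by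
  have hint : IsIntegral k⟦X⟧ t := Algebra.IsIntegral.isIntegral t
  have hX0 : algebraMap k⟦X⟧ B PowerSeries.X ≠ 0 :=
    (map_ne_zero_iff _ (FaithfulSMul.algebraMap_injective k⟦X⟧ B)).2 PowerSeries.X_ne_zero
  obtain ⟨e, u, hX⟩ := IsDiscreteValuationRing.eq_unit_mul_pow_irreducible hX0 ht
  set m := minpoly k⟦X⟧ t with hmdef
  have hm : m.Monic := minpoly.monic hint
  have hroot : Polynomial.aeval t m = 0 := minpoly.aeval _ _
  set n := m.natDegree with hn
  -- The degree of `m` is at most the value of `X`.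
  have hne : n ≤ e := by
    obtain ⟨P, hP, hPt⟩ := exists_aeval_uniformizer_eq ht hX (t ^ e)
    have h1 := minpoly.min k⟦X⟧ t (Polynomial.monic_X_pow_sub hP) (by simp [hPt])
    rw [← hmdef, Polynomial.degree_sub_eq_left_of_degree_lt (by simpa using hP),
      Polynomial.degree_X_pow, Polynomial.degree_eq_natDegree hm.ne_zero] at h1
    exact_mod_cast h1
  -- The constant coefficient of `m` is not a unit since it is a multiple of `t` in `B`.
  have h0 : m.coeff 0 ∈ maximalIdeal k⟦X⟧ := by
    rw [mem_maximalIdeal, mem_nonunits_iff]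
    intro hu
    obtain ⟨q, hq⟩ := Polynomial.X_dvd_sub_C (p := m)
    have h2 := congrArg (Polynomial.aeval t) hq
    rw [map_sub, hroot, Polynomial.aeval_C, map_mul, Polynomial.aeval_X, zero_sub] at h2
    exact ht.not_isUnit (isUnit_of_mul_isUnit_left (h2 ▸ (hu.map (algebraMap k⟦X⟧ B)).neg))
  have hdist := isDistinguishedAt_of_irreducible hm (minpoly.irreducible hint) h0
  obtain ⟨Q, hQ⟩ : Polynomial.C PowerSeries.X ∣ m - Polynomial.X ^ n := by
    rw [Polynomial.C_dvd_iff_dvd_coeff]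
    intro i
    rw [Polynomial.coeff_sub, Polynomial.coeff_X_pow]
    split_ifs with hi
    · rw [hi, hn, hm.coeff_natDegree, sub_self]
      exact dvd_zero _
    · rw [sub_zero]
      rcases lt_or_gt_of_ne hi with h | h
      · have := hdist.mem h
        rwa [PowerSeries.maximalIdeal_eq_span_X, Ideal.mem_span_singleton] at this
      · rw [Polynomial.coeff_eq_zero_of_natDegree_lt h]
        exact dvd_zero _
  have hmQ : m = Polynomial.X ^ n + Polynomial.C PowerSeries.X * Q := by rw [← hQ]; ring
  have hQt : IsUnit (Polynomial.aeval t Q) := by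
    have h1 := hroot
    rw [hmQ, map_add, map_pow, Polynomial.aeval_X, map_mul, Polynomial.aeval_C, hX,
      show e = n + (e - n) by omega, pow_add] at h1
    have h2 : t ^ n * (1 + (u * t ^ (e - n)) * Polynomial.aeval t Q) = 0 := by
      rw [← h1]; ring
    have h3 := (mul_eq_zero.1 h2).resolve_left (pow_ne_zero _ ht.ne_zero)
    refine IsUnit.of_mul_eq_one (-(u * t ^ (e - n))) ?_
    linear_combination -h3
  have hder : Differential.mapCoeffs m = Q + Polynomial.C PowerSeries.X * Differential.mapCoeffs Q
      := by
    rw [hmQ, mapCoeffs_X_pow_add_C_mul, deriv_powerSeries, PowerSeries.derivative_X, map_one,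
      one_mul]
  rw [hder, map_add, map_mul, Polynomial.aeval_C]
  -- A unit plus a multiple of `X` is a unit of `B`.
  by_contra hnu
  refine hnu ((IsLocalRing.notMem_maximalIdeal).1 fun hmem => ?_)
  have hXm : algebraMap k⟦X⟧ B PowerSeries.X ∈ maximalIdeal B := by
    rw [(IsDiscreteValuationRing.irreducible_iff_uniformizer t).1 ht, Ideal.mem_span_singleton]
    exact uniformizer_dvd_X ht
  have := (Ideal.add_mem_iff_left _ (Ideal.mul_mem_right
    (Polynomial.aeval t (Differential.mapCoeffs Q)) _ hXm)).1 hmem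
  exact (IsLocalRing.notMem_maximalIdeal.2 hQt) this

/-- The normalization `B` carries a derivation `d/dt`, for every uniformizer `t`, and the different
of `B` over `k⟦X⟧`, generated by the derivative of the minimal polynomial of `t`, is generated by
`dX/dt`. -/
theorem exists_derivation_uniformizer [IsAlgClosed k] [Module.Finite k⟦X⟧ B]
    [FaithfulSMul k⟦X⟧ B] (ht : Irreducible t) :
    ∃ D : Derivation ℤ B B, D t = 1 ∧
      (∀ a : k, D (algebraMap k⟦X⟧ B (PowerSeries.C a)) = 0) ∧
      Associated (D (algebraMap k⟦X⟧ B PowerSeries.X))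
        (Polynomial.aeval t (Polynomial.derivative (minpoly k⟦X⟧ t))) := by
  have hsurj : Function.Surjective (Polynomial.aeval (R := k⟦X⟧) t) := by
    intro b
    have hb : b ∈ Algebra.adjoin k⟦X⟧ {t} := by
      rw [adjoin_uniformizer_eq_top ht]
      trivial
    rw [Algebra.adjoin_singleton_eq_range_aeval] at hb
    exact hb
  have : Module.IsTorsionFree k⟦X⟧ B := inferInstance
  obtain ⟨D, ξ, hDt, hD, hξ⟩ := exists_derivation hsurj
    (fun P => minpoly.isIntegrallyClosed_dvd_iff (Algebra.IsIntegral.isIntegral t) P)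
    (isUnit_aeval_mapCoeffs_minpoly ht)
  refine ⟨D, hDt, fun a => ?_, ?_⟩
  · rw [hD, deriv_powerSeries, PowerSeries.derivative_C, map_zero, mul_zero]
  · rwa [hD, deriv_powerSeries, PowerSeries.derivative_X, map_one, mul_one]

/-! ### Values of derivatives -/

/-- If `b` has value `n`, then `db/dt` has value at least `n - 1`, with equality exactly if `n` is
nonzero in `k`. -/
theorem addVal_derivation (p : ℕ) [CharP k p] {D : Derivation ℤ B B}
    (ht : Irreducible t) (hD : D t = 1) {b : B} {n : ℕ}
    (hn : IsDiscreteValuationRing.addVal B b = n) :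
    (n : ℕ∞) ≤ IsDiscreteValuationRing.addVal B (D b) + 1 ∧
      (IsDiscreteValuationRing.addVal B (D b) + 1 = n ↔ ¬ p ∣ n) := by
  have hb0 : b ≠ 0 := by
    rintro rfl
    simp at hn
  obtain ⟨n', u, rfl⟩ := IsDiscreteValuationRing.eq_unit_mul_pow_irreducible hb0 ht
  have hnn := hn
  rw [IsDiscreteValuationRing.addVal_def _ u ht n' rfl, Nat.cast_inj] at hnn
  subst hnn
  have hcast : (n' : B) = algebraMap k⟦X⟧ B (PowerSeries.C (n' : k)) := by simp
  rcases n' with _ | n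
  · simp
  have hDb : D (u * t ^ (n + 1)) = t ^ n * (t * D u + u * (n + 1 : ℕ)) := by
    rw [Derivation.leibniz, Derivation.leibniz_pow, hD]
    simp only [smul_eq_mul, nsmul_eq_mul, Nat.add_sub_cancel, mul_one]
    ring
  have hv : IsDiscreteValuationRing.addVal B (D (u * t ^ (n + 1))) =
      n + IsDiscreteValuationRing.addVal B (t * D u + u * (n + 1 : ℕ)) := by
    rw [hDb, AddValuation.map_mul, AddValuation.map_pow,
      IsDiscreteValuationRing.addVal_uniformizer ht]
    simp
  by_cases hp : p ∣ n + 1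
  · have h0 : ((n + 1 : ℕ) : B) = 0 := by
      rw [hcast, (CharP.cast_eq_zero_iff k p _).2 hp]
      simp
    rw [h0, mul_zero, add_zero, AddValuation.map_mul,
      IsDiscreteValuationRing.addVal_uniformizer ht] at hv
    rw [hv]
    constructor
    · push_cast
      rw [← add_assoc, add_assoc _ _ (1 : ℕ∞)]
      exact le_self_add
    · simp only [hp, not_true_eq_false, iff_false]
      intro h
      generalize IsDiscreteValuationRing.addVal B (D u) = w at h
      induction w using ENat.recTopCoe with
      | top => simp at h; exact absurd h (by exact ENat.top_ne_natCast _)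
      | coe w => norm_cast at h; omega
  · have hu : IsUnit (t * D u + u * (n + 1 : ℕ)) := by
      rw [← IsLocalRing.notMem_maximalIdeal,
        (IsDiscreteValuationRing.irreducible_iff_uniformizer t).1 ht, Ideal.add_mem_iff_right _
          (Ideal.mul_mem_right _ _ (Ideal.mem_span_singleton_self t)),
        ← (IsDiscreteValuationRing.irreducible_iff_uniformizer t).1 ht,
        IsLocalRing.notMem_maximalIdeal]
      refine u.isUnit.mul ?_
      rw [hcast]
      exact ((Ne.isUnit fun h => hp ((CharP.cast_eq_zero_iff k p _).1 h)).map PowerSeries.C).map _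
    have h1 : IsDiscreteValuationRing.addVal B (t * D u + u * (n + 1 : ℕ)) = 0 :=
      IsDiscreteValuationRing.addVal_eq_zero_iff.2 hu
    rw [hv, h1]
    simp [hp]

end Derivation

/-! ### The chain rule -/

section ChainRule

variable {k : Type*} [Field k]

theorem exists_eq_C_add_X_mul (G : MvPowerSeries (Fin 2) k) :
    ∃ (a : k) (H : Fin 2 → MvPowerSeries (Fin 2) k),
      G = MvPowerSeries.C a + ∑ i, MvPowerSeries.X i * H i := by
  let e : Fin 2 ≃ Option Unit := (finSuccEquiv 1).trans
    (Equiv.optionCongr (Equiv.ofUnique (Fin 1) Unit))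
  have h0 : e.symm none = 0 := by decide
  have h1 : e.symm (some ()) = 1 := by decide
  obtain ⟨F, b, hF⟩ : ∃ F b, splitEquiv k e G = PowerSeries.X * F + PowerSeries.C b :=
    ⟨_, _, PowerSeries.eq_X_mul_shift_add_const _⟩
  obtain ⟨b', a, hb⟩ : ∃ b' a, b = PowerSeries.X * b' + PowerSeries.C a :=
    ⟨_, _, PowerSeries.eq_X_mul_shift_add_const _⟩
  refine ⟨a, ![(splitEquiv k e).symm F, (splitEquiv k e).symm (PowerSeries.C b')], ?_⟩
  apply (splitEquiv k e).injective
  rw [hF, hb, Fin.sum_univ_two, map_add, map_add, map_add, map_mul, map_mul, map_mul, splitEquiv_C, ← h0, ← h1,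
    splitEquiv_X_outer, splitEquiv_X_inner, h0, h1]
  simp
  ring

variable {B : Type*} [CommRing B]

/-- The chain rule for a ring homomorphism `ψ` from a power series ring and a derivation `D` of the
target that kills the image of the constants. The defect of the chain rule is a derivation along `ψ`
that kills the constants and the indeterminates, hence takes values in every power of the ideal. -/
theorem derivation_comp_eq_sum [IsDomain B] [IsNoetherianRing B] [IsLocalRing B]
    (ψ : MvPowerSeries (Fin 2) k →+* B) (D : Derivation ℤ B B)
    (hC : ∀ a, D (ψ (MvPowerSeries.C a)) = 0)
    (hX : ∀ i, ψ (MvPowerSeries.X i) ∈ maximalIdeal B) (G : MvPowerSeries (Fin 2) k) :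
    D (ψ G) = ∑ i, ψ (MvPowerSeries.pderiv k i G) * D (ψ (MvPowerSeries.X i)) := by
  let δ : MvPowerSeries (Fin 2) k → B := fun G =>
    D (ψ G) - ∑ i, ψ (MvPowerSeries.pderiv k i G) * D (ψ (MvPowerSeries.X i))
  have hδ : ∀ G, δ G = D (ψ G) -
      ∑ i, ψ (MvPowerSeries.pderiv k i G) * D (ψ (MvPowerSeries.X i)) := fun _ => rfl
  have key : ∀ n G, δ G ∈ maximalIdeal B ^ n := by
    intro n
    induction n with
    | zero => simp
    | succ n ih =>
      intro G
      obtain ⟨a, H, rfl⟩ := exists_eq_C_add_X_mul G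
      have h : δ (MvPowerSeries.C a + ∑ i, MvPowerSeries.X i * H i) =
          ∑ i, ψ (MvPowerSeries.X i) * δ (H i) := by
        simp only [hδ, map_add, hC, Fin.sum_univ_two, Derivation.leibniz, MvPowerSeries.pderiv_C,
          map_mul, MvPowerSeries.pderiv_X, smul_eq_mul, map_zero]
        simp
        ring
      rw [h, pow_succ']
      exact Ideal.sum_mem _ fun i _ => Ideal.mul_mem_mul (hX i) (ih _)
  rw [← sub_eq_zero, ← hδ, ← Ideal.mem_bot,
    ← Ideal.iInf_pow_eq_bot_of_isLocalRing (maximalIdeal B) (Ideal.IsPrime.ne_top inferInstance),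
    Ideal.mem_iInf]
  exact fun n => key n G

end ChainRule

/-! ### The conductor -/

section Conductor

variable {k : Type*} [Field k] [IsAlgClosed k] {B : Type*} [CommRing B] [IsDomain B]
  [Algebra k⟦X⟧ B] [Algebra.IsIntegral k⟦X⟧ B] [IsDiscreteValuationRing B] {t : B}

/-- If a subring `O` of `B` contains the constants and an element of every value `≥ α`, then every
element of value `≥ α` is congruent to an element of `O` modulo arbitrarily high powers of `t`. -/
theorem exists_mem_pow_dvd_sub {O : Subring B}
    (hk : ∀ a : k, algebraMap k⟦X⟧ B (PowerSeries.C a) ∈ O) (ht : Irreducible t) {α : ℕ}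
    (hα : ∀ n : ℕ, ∃ g ∈ O, IsDiscreteValuationRing.addVal B g = ((α + n : ℕ) : ℕ∞)) (n : ℕ)
    {b : B} (hb : t ^ α ∣ b) : ∃ g ∈ O, t ^ (α + n) ∣ b - g := by
  induction n with
  | zero => exact ⟨0, O.zero_mem, by simpa using hb⟩
  | succ n ih =>
    obtain ⟨g, hg, c, hc⟩ := ih
    obtain ⟨g', hg', hv⟩ := hα n
    have hg0 : g' ≠ 0 := by
      rintro rfl
      rw [AddValuation.map_zero] at hv
      exact ENat.top_ne_natCast _ hv
    obtain ⟨m, u, rfl⟩ := IsDiscreteValuationRing.eq_unit_mul_pow_irreducible hg0 ht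
    rw [IsDiscreteValuationRing.addVal_def _ u ht m rfl, Nat.cast_inj] at hv
    subst hv
    obtain ⟨a, d, hd⟩ := exists_constant_sub_dvd (k := k) ht ((↑u⁻¹ : B) * c)
    refine ⟨g + algebraMap k⟦X⟧ B (PowerSeries.C a) * (u * t ^ (α + n)),
      O.add_mem hg (O.mul_mem (hk a) hg'), u * d, ?_⟩
    linear_combination hc + t ^ (α + n) * u * hd - t ^ (α + n) * c * u.mul_inv

/-- The conductor of the value semigroup of a subring `O` of `B` is the exponent of the conductor
ideal of `O` in `B`. -/
theorem sInf_values_eq_of_conductor {O : Subring B}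
    (hk : ∀ a : k, algebraMap k⟦X⟧ B (PowerSeries.C a) ∈ O) (ht : Irreducible t) {c : ℕ}
    (hc : ∀ b : B, (∀ b', b * b' ∈ O) ↔ t ^ c ∣ b) :
    sInf {α : ℕ | (∃ g ∈ O, IsDiscreteValuationRing.addVal B g = (α : ℕ∞)) ∧
      ∀ n : ℕ, ∃ g ∈ O, IsDiscreteValuationRing.addVal B g = ((α + n : ℕ) : ℕ∞)} = c := by
  have hpow : ∀ n : ℕ, IsDiscreteValuationRing.addVal B (t ^ n) = n := fun n =>
    IsDiscreteValuationRing.addVal_def _ 1 ht n (by simp)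
  have hmem : ∀ n : ℕ, t ^ (c + n) ∈ O := fun n => by
    rw [pow_add]
    exact (hc _).2 dvd_rfl _
  have hcS : c ∈ {α : ℕ | (∃ g ∈ O, IsDiscreteValuationRing.addVal B g = (α : ℕ∞)) ∧
      ∀ n : ℕ, ∃ g ∈ O, IsDiscreteValuationRing.addVal B g = ((α + n : ℕ) : ℕ∞)} :=
    ⟨⟨_, hmem 0, hpow _⟩, fun n => ⟨_, hmem n, hpow _⟩⟩
  refine le_antisymm (Nat.sInf_le hcS) (le_csInf ⟨c, hcS⟩ ?_)
  rintro α ⟨-, hα⟩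
  have h1 : t ^ c ∣ t ^ α := by
    rw [← hc]
    intro b'
    obtain ⟨g, hg, h⟩ := exists_mem_pow_dvd_sub hk ht hα c (Dvd.intro b' rfl : t ^ α ∣ t ^ α * b')
    have h2 := (hc _).2 ((pow_dvd_pow t (Nat.le_add_left c α)).trans h) 1
    rw [mul_one] at h2
    simpa using O.add_mem h2 hg
  exact (pow_dvd_pow_iff ht.ne_zero ht.not_isUnit).1 h1

end Conductor

/-! ### The different -/

/-- A generator of a ring extension `S` of `A` that is algebraic over the field `K ⊇ A` generates
the fraction field of `S` over `K`. -/
theorem adjoin_algebraMap_eq_top {A K S L : Type*} [CommRing A] [Field K] [CommRing S] [Field L]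
    [Algebra A K] [Algebra A S] [Algebra A L] [Algebra K L] [Algebra S L] [IsScalarTower A K L]
    [IsScalarTower A S L] [IsFractionRing S L] {y : S} (hy : IsIntegral A y)
    (h : Algebra.adjoin A {y} = ⊤) : Algebra.adjoin K {algebraMap S L y} = ⊤ := by
  have hyK : IsIntegral K (algebraMap S L y) := (hy.algebraMap (B := L)).tower_top
  have hS : ∀ r : S, algebraMap S L r ∈ IntermediateField.adjoin K {algebraMap S L y} := by
    intro r
    have hr : r ∈ Algebra.adjoin A {y} := by
      rw [h]
      trivial
    rw [Algebra.adjoin_singleton_eq_range_aeval] at hr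
    obtain ⟨Q, rfl⟩ := hr
    rw [AlgHom.toRingHom_eq_coe, AlgHom.coe_toRingHom, ← Polynomial.aeval_algebraMap_apply,
      ← Polynomial.aeval_map_algebraMap K]
    exact IntermediateField.algebra_adjoin_le_adjoin _ _ (Polynomial.aeval_mem_adjoin_singleton _ _)
  rw [← IntermediateField.adjoin_simple_toSubalgebra_of_isAlgebraic hyK.isAlgebraic, eq_top_iff]
  intro z _
  obtain ⟨r, s, -, rfl⟩ := IsFractionRing.div_surjective (A := S) z
  exact (IntermediateField.adjoin K {algebraMap S L y}).div_mem (hS r) (hS s)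

/-- Let `R = k⟦X⟧[Y] / (W)` be a domain whose class `y` of `Y` satisfies `W'(y) ≠ 0`. Its
normalization is a discrete valuation ring, finite over `k⟦X⟧`, and `W'(y)` generates the product of
the conductor of `R` and of the different. The different is generated by the derivative of the
minimal polynomial of `t` since `B = k⟦X⟧[t]`. -/
theorem exists_conductor_mul_different {k : Type*} [Field k] [IsAlgClosed k] {R : Type*}
    (L B : Type*) [CommRing R] [IsDomain R] [Field L] [Algebra R L] [IsFractionRing R L]
    [CommRing B] [Algebra R B] [Algebra B L] [IsScalarTower R B L] [IsIntegralClosure B R L]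
    [Algebra k⟦X⟧ R] [Algebra k⟦X⟧ L] [Algebra k⟦X⟧ B] [IsScalarTower k⟦X⟧ R L]
    [IsScalarTower k⟦X⟧ R B] [IsScalarTower k⟦X⟧ B L] {y : R} {W : Polynomial k⟦X⟧} (hW : W.Monic)
    (hsurj : Function.Surjective (Polynomial.aeval (R := k⟦X⟧) y))
    (hker : ∀ Q, Polynomial.aeval y Q = 0 ↔ W ∣ Q)
    (hsep : Polynomial.aeval y (Polynomial.derivative W) ≠ 0) :
    ∃ (_ : IsDomain B) (_ : IsDiscreteValuationRing B), Module.Finite k⟦X⟧ B ∧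
      FaithfulSMul k⟦X⟧ B ∧ ∀ t : B, Irreducible t → ∃ c : ℕ,
        (∀ b : B, (∀ b', b * b' ∈ (algebraMap R B).range) ↔ t ^ c ∣ b) ∧
        Associated (algebraMap R B (Polynomial.aeval y (Polynomial.derivative W)))
          (t ^ c * Polynomial.aeval t (Polynomial.derivative (minpoly k⟦X⟧ t))) := by
  have hBL : Function.Injective (algebraMap B L) := IsIntegralClosure.algebraMap_injective B R L
  have hRL : Function.Injective (algebraMap R L) := IsFractionRing.injective R L
  have hAR : Function.Injective (algebraMap k⟦X⟧ R) := by
    rw [injective_iff_map_eq_zero]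
    intro a ha
    have h1 : W ∣ Polynomial.C a := by
      rw [← hker, Polynomial.aeval_C, ha]
    by_contra h0
    have hdeg : W.degree ≤ 0 := (Polynomial.degree_le_of_dvd h1 (by simpa using h0)).trans
      Polynomial.degree_C_le
    have hW1 : W = 1 := Polynomial.eq_one_of_monic_natDegree_zero hW
      (Polynomial.natDegree_eq_zero_iff_degree_le_zero.2 hdeg)
    apply hsep
    rw [hW1]
    simp
  have hAL : Function.Injective (algebraMap k⟦X⟧ L) := by
    rw [IsScalarTower.algebraMap_eq k⟦X⟧ R L]
    exact hRL.comp hAR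
  have hAB : Function.Injective (algebraMap k⟦X⟧ B) := by
    rw [IsScalarTower.algebraMap_eq k⟦X⟧ B L] at hAL
    exact Function.Injective.of_comp hAL
  have hdom : IsDomain B := hBL.isDomain (algebraMap B L)
  have fAL : FaithfulSMul k⟦X⟧ L := (faithfulSMul_iff_algebraMap_injective _ _).2 hAL
  have fAB : FaithfulSMul k⟦X⟧ B := (faithfulSMul_iff_algebraMap_injective _ _).2 hAB
  have fAR : FaithfulSMul k⟦X⟧ R := (faithfulSMul_iff_algebraMap_injective _ _).2 hAR
  have hy : IsIntegral k⟦X⟧ y := ⟨W, hW, by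
    rw [← Polynomial.aeval_def]
    exact (hker W).2 dvd_rfl⟩
  have hRtop : Algebra.adjoin k⟦X⟧ {y} = ⊤ := by
    rw [Algebra.adjoin_singleton_eq_range_aeval, AlgHom.range_eq_top]
    exact hsurj
  have hRfin : Module.Finite k⟦X⟧ R := by
    refine ⟨?_⟩
    rw [← Algebra.top_toSubmodule, ← hRtop]
    exact hy.fg_adjoin_singleton
  -- `B` is also the integral closure of `k⟦X⟧` in `L`.
  have hBcl : IsIntegralClosure B k⟦X⟧ L := by
    refine ⟨hBL, fun {z} => ⟨fun hz => ?_, ?_⟩⟩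
    · exact (IsIntegralClosure.isIntegral_iff (A := B) (R := R)).1 hz.tower_top
    · rintro ⟨b, rfl⟩
      exact isIntegral_trans (R := k⟦X⟧) (A := R) _
        ((IsIntegralClosure.isIntegral_iff (A := B) (R := R)).2 ⟨b, rfl⟩)
  let K := FractionRing k⟦X⟧
  let : Algebra K L := FractionRing.liftAlgebra k⟦X⟧ L
  have : IsScalarTower k⟦X⟧ K L := FractionRing.isScalarTower_liftAlgebra k⟦X⟧ L
  have hyL : IsIntegral k⟦X⟧ (algebraMap R L y) := hy.algebraMap
  have hyK : IsIntegral K (algebraMap R L y) := hyL.tower_top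
  have hminR : minpoly k⟦X⟧ y = W := by
    refine Polynomial.eq_of_monic_of_associated (minpoly.monic hy) hW
      (associated_of_dvd_dvd ?_ ((hker _).1 (minpoly.aeval _ _)))
    exact (minpoly.isIntegrallyClosed_dvd_iff hy W).1 ((hker W).2 dvd_rfl)
  have hadj := adjoin_algebraMap_eq_top (K := K) (L := L) hy hRtop
  have hadj' : IntermediateField.adjoin K {algebraMap R L y} = ⊤ := by
    rw [← IntermediateField.toSubalgebra_inj,
      IntermediateField.adjoin_simple_toSubalgebra_of_isAlgebraic hyK.isAlgebraic, hadj]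
    rfl
  have hminL : minpoly k⟦X⟧ (algebraMap R L y) = W := by
    rw [minpoly.algebraMap_eq hRL, hminR]
  have hfin : FiniteDimensional K L := by
    have h1 := IntermediateField.adjoin.finiteDimensional hyK
    rw [hadj'] at h1
    exact IntermediateField.topEquiv.toLinearEquiv.finiteDimensional
  have hsepy : IsSeparable K (algebraMap R L y) := by
    rw [IsSeparable, Polynomial.separable_iff_derivative_ne_zero (minpoly.irreducible hyK),
      minpoly.isIntegrallyClosed_eq_field_fractions' K hyL, hminL, Polynomial.derivative_map]
    intro h0
    rw [Polynomial.map_eq_zero_iff (IsFractionRing.injective k⟦X⟧ K)] at h0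
    exact hsep (by rw [h0, map_zero])
  have hsepL : Algebra.IsSeparable K L := by
    have h1 := (IntermediateField.isSeparable_adjoin_simple_iff_isSeparable K L).2 hsepy
    rw [hadj'] at h1
    exact Algebra.IsSeparable.of_algHom K _ IntermediateField.topEquiv.symm.toAlgHom
  have hBfin : Module.Finite k⟦X⟧ B := IsIntegralClosure.finite k⟦X⟧ K L B
  have hBded : IsDedekindDomain B := IsIntegralClosure.isDedekindDomain k⟦X⟧ K L B
  have hdvr : IsDiscreteValuationRing B := isDiscreteValuationRing_of_isDedekindDomain (k := k)
  refine ⟨hdom, hdvr, hBfin, fAB, fun t ht => ?_⟩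
  have htop := adjoin_uniformizer_eq_top (k := k) ht
  have hBfrac : IsFractionRing B L :=
    IsIntegralClosure.isFractionRing_of_finite_extension k⟦X⟧ K L B
  have htopL := adjoin_algebraMap_eq_top (K := K) (L := L)
    (Algebra.IsIntegral.isIntegral (R := k⟦X⟧) t) htop
  have hcy := conductor_mul_differentIdeal k⟦X⟧ K L (algebraMap R B y)
    (by rw [← IsScalarTower.algebraMap_apply]; exact hadj)
  have hct := conductor_mul_differentIdeal k⟦X⟧ K L t htopL
  rw [conductor_eq_top_of_adjoin_eq_top htop, Ideal.top_mul] at hct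
  have hRB : Function.Injective (algebraMap R B) := by
    rw [IsScalarTower.algebraMap_eq R B L] at hRL
    exact Function.Injective.of_comp hRL
  rw [hct, minpoly.algebraMap_eq hRB, hminR, Polynomial.aeval_algebraMap_apply] at hcy
  have hc0 : _root_.conductor k⟦X⟧ (algebraMap R B y) ≠ ⊥ := by
    intro h0
    rw [h0, Ideal.bot_mul, eq_comm, Ideal.span_singleton_eq_bot] at hcy
    exact hsep (hRB (by rw [hcy, map_zero]))
  obtain ⟨c, hc⟩ := IsDiscreteValuationRing.ideal_eq_span_pow_irreducible hc0 ht
  refine ⟨c, fun b => ?_, ?_⟩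
  · have hrange : ∀ b : B, b ∈ (algebraMap R B).range ↔
        b ∈ Algebra.adjoin k⟦X⟧ {algebraMap R B y} := by
      intro b
      have h1 := AlgHom.map_adjoin_singleton (IsScalarTower.toAlgHom k⟦X⟧ R B) y
      rw [IsScalarTower.coe_toAlgHom', hRtop, Algebra.map_top] at h1
      rw [← h1]
      rfl
    simp only [hrange]
    rw [← mem_conductor_iff, hc, Ideal.mem_span_singleton]
  · rw [hc, Ideal.span_singleton_mul_span_singleton, Ideal.span_singleton_eq_span_singleton] at hcy
    exact hcy.symm

/-! ### The value of the bracket -/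

theorem val_eq_addVal {k : Type*} [Field k] (f : MvPowerSeries (Fin 2) k)
    [IsDomain (Normalization f)] [IsDiscreteValuationRing (Normalization f)] (g : LocalRing f) :
    val f g = IsDiscreteValuationRing.addVal (Normalization f)
      (algebraMap (LocalRing f) (Normalization f) g) := by
  obtain ⟨t, ht⟩ := IsDiscreteValuationRing.exists_irreducible (Normalization f)
  have hmem : ∀ n : ℕ, algebraMap (LocalRing f) (Normalization f) g ∈
      Ring.jacobson (Normalization f) ^ n ↔ (n : ℕ∞) ≤
        IsDiscreteValuationRing.addVal (Normalization f)
          (algebraMap (LocalRing f) (Normalization f) g) := by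
    intro n
    rw [IsLocalRing.ringJacobson_eq_maximalIdeal,
      (IsDiscreteValuationRing.irreducible_iff_uniformizer t).1 ht, Ideal.span_singleton_pow,
      Ideal.mem_span_singleton, ← IsDiscreteValuationRing.addVal_le_iff_dvd,
      IsDiscreteValuationRing.addVal_def (t ^ n) 1 ht n (by simp)]
  simp only [val, hmem]
  refine le_antisymm (iSup₂_le fun n h => h) ?_
  exact ENat.forall_natCast_le_iff_le.1 fun n h => le_iSup₂_of_le n h le_rfl

section Bracket

variable {k : Type*} [Field k] {B : Type*} [CommRing B]

/-- Modulo `f`, the bracket `[f, G]` times `dX/dt` is `± f_Y` times `dG/dt`. -/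
theorem associated_bracket_mul {f : MvPowerSeries (Fin 2) k} (e : Fin 2 ≃ Option Unit)
    (ψ : MvPowerSeries (Fin 2) k →+* B) (D : Derivation ℤ B B)
    (hchain : ∀ G, D (ψ G) = ∑ i, ψ (MvPowerSeries.pderiv k i G) * D (ψ (MvPowerSeries.X i)))
    (hf : ψ f = 0) (G : MvPowerSeries (Fin 2) k) :
    Associated (ψ (MvPowerSeries.pderiv k 0 f * MvPowerSeries.pderiv k 1 G
      - MvPowerSeries.pderiv k 1 f * MvPowerSeries.pderiv k 0 G) *
        D (ψ (MvPowerSeries.X (e.symm (some ())))))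
      (ψ (MvPowerSeries.pderiv k (e.symm none) f) * D (ψ G)) := by
  have h1 := hchain f
  have h2 := hchain G
  rw [hf, map_zero, Fin.sum_univ_two] at h1
  rw [Fin.sum_univ_two] at h2
  have hne : e.symm none ≠ e.symm (some ()) := by simp
  rw [map_sub, map_mul, map_mul]
  generalize e.symm none = j at *
  generalize e.symm (some ()) = i at *
  obtain ⟨rfl, rfl⟩ | ⟨rfl, rfl⟩ : (j = 0 ∧ i = 1) ∨ (j = 1 ∧ i = 0) := by omega
  · refine Associated.of_eq ?_
    linear_combination (-ψ (MvPowerSeries.pderiv k 0 f)) * h2 +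
      ψ (MvPowerSeries.pderiv k 0 G) * h1
  · rw [← Associated.neg_right_iff]
    refine Associated.of_eq ?_
    linear_combination ψ (MvPowerSeries.pderiv k 1 f) * h2 -
      ψ (MvPowerSeries.pderiv k 1 G) * h1

end Bracket

/-- The normalization of an irreducible `f` is a discrete valuation ring, in which
`v([f, g]) = c(f) + v(dg/dt)` for every uniformizer `t`. -/
theorem exists_derivation_val_bracket {k : Type*} [Field k] [IsAlgClosed k]
    {f : MvPowerSeries (Fin 2) k} (hf : Irreducible f) :
    ∃ (_ : IsDomain (Normalization f)) (_ : IsDiscreteValuationRing (Normalization f))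
      (_ : Algebra k⟦X⟧ (Normalization f)) (t : Normalization f)
      (D : Derivation ℤ (Normalization f) (Normalization f)),
      Function.Injective (algebraMap (LocalRing f) (Normalization f)) ∧ Irreducible t ∧ D t = 1 ∧
      ∀ g, IsDiscreteValuationRing.addVal (Normalization f)
          (algebraMap (LocalRing f) (Normalization f) (bracket f g)) =
        conductor f + IsDiscreteValuationRing.addVal (Normalization f)
          (D (algebraMap (LocalRing f) (Normalization f) g)) := by
  obtain ⟨e, hreg, hsep⟩ := exists_regular_separable hf
  obtain ⟨W, hWm, hsurj, hker, u, hu, hfu⟩ := exists_weierstrass_presentation e hreg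
  have hprime : (Ideal.span {f}).IsPrime :=
    (Ideal.span_singleton_prime hf.ne_zero).2 hf.prime
  have hdomR : IsDomain (LocalRing f) := Ideal.Quotient.isDomain _
  let algR : Algebra k⟦X⟧ (LocalRing f) := (innerMap e f).toAlgebra
  let algB : Algebra k⟦X⟧ (Normalization f) :=
    ((algebraMap (LocalRing f) (Normalization f)).comp (innerMap e f)).toAlgebra
  have tRL : IsScalarTower k⟦X⟧ (LocalRing f) (FractionRing (LocalRing f)) :=
    inferInstance
  have tRB : IsScalarTower k⟦X⟧ (LocalRing f) (Normalization f) :=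
    IsScalarTower.of_algebraMap_eq fun _ => rfl
  have tBL : IsScalarTower k⟦X⟧ (Normalization f) (FractionRing (LocalRing f)) :=
    IsScalarTower.of_algebraMap_eq fun _ => rfl
  have haeval : ∀ Q : Polynomial k⟦X⟧, Q.eval₂ (innerMap e f) (outerVar e f) =
      Polynomial.aeval (outerVar e f) Q := fun _ => rfl
  simp only [haeval] at hsurj hker hfu
  have hfu0 : Ideal.Quotient.mk (Ideal.span {f}) (MvPowerSeries.pderiv k (e.symm none) f) ≠ 0 := by
    rwa [Ne, Ideal.Quotient.eq_zero_iff_mem, Ideal.mem_span_singleton]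
  have hsepW : Polynomial.aeval (outerVar e f) (Polynomial.derivative W) ≠ 0 := by
    intro h0
    apply hfu0
    rw [hfu]
    exact mul_eq_zero_of_right _ h0
  obtain ⟨hdom, hdvr, hfin, hfaith, hcond⟩ := exists_conductor_mul_different
    (FractionRing (LocalRing f)) (Normalization f) (y := outerVar e f) hWm hsurj hker hsepW
  have hRB : Function.Injective (algebraMap (LocalRing f) (Normalization f)) := by
    have h1 := IsFractionRing.injective (LocalRing f) (FractionRing (LocalRing f))
    rw [IsScalarTower.algebraMap_eq (LocalRing f) (Normalization f)
      (FractionRing (LocalRing f)), RingHom.coe_comp] at h1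
    exact Function.Injective.of_comp h1
  obtain ⟨t, ht⟩ := IsDiscreteValuationRing.exists_irreducible (Normalization f)
  obtain ⟨c, hc, hcW⟩ := hcond t ht
  obtain ⟨D, hDt, hDC, hDX⟩ := exists_derivation_uniformizer (k := k) ht
  refine ⟨hdom, hdvr, algB, t, D, hRB, ht, hDt, ?_⟩
  let ψ : MvPowerSeries (Fin 2) k →+* Normalization f :=
    (algebraMap (LocalRing f) (Normalization f)).comp (Ideal.Quotient.mk (Ideal.span {f}))
  have hψ : ∀ G, ψ G = algebraMap (LocalRing f) (Normalization f)
    (Ideal.Quotient.mk (Ideal.span {f}) G) := fun _ => rfl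
  have hψC : ∀ a, ψ (MvPowerSeries.C a) = algebraMap k⟦X⟧ (Normalization f) (PowerSeries.C a) := by
    intro a
    rw [hψ, ← innerMap_C e]
    rfl
  have hψX : ψ (MvPowerSeries.X (e.symm (some ()))) =
      algebraMap k⟦X⟧ (Normalization f) PowerSeries.X := by
    rw [hψ, ← innerMap_X e]
    rfl
  have hψf : ψ f = 0 := by
    rw [hψ, Ideal.Quotient.eq_zero_iff_mem.2 (Ideal.mem_span_singleton_self f), map_zero]
  -- `X i - a` is invertible for every nonzero constant `a`, so that `X i` has residue `0`.
  have hmax : ∀ i, ψ (MvPowerSeries.X i) ∈ maximalIdeal (Normalization f) := by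
    intro i
    obtain ⟨a, ha⟩ := exists_constant_sub_mem_ringJacobson (k := k) (ψ (MvPowerSeries.X i))
    rw [IsLocalRing.ringJacobson_eq_maximalIdeal, ← hψC, ← map_sub] at ha
    by_cases h0 : a = 0
    · simpa [h0] using ha
    · refine absurd ?_ ((mem_maximalIdeal _).1 ha)
      refine IsUnit.map ψ (MvPowerSeries.isUnit_iff_constantCoeff.2 ?_)
      simpa using h0
  have hchain := derivation_comp_eq_sum ψ D (fun a => by rw [hψC, hDC]) hmax
  have hcf : conductor f = c := by
    rw [← sInf_values_eq_of_conductor (k := k) (O := (algebraMap (LocalRing f)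
      (Normalization f)).range) (fun a => ⟨innerMap e f (PowerSeries.C a), rfl⟩) ht hc]
    simp only [conductor, valueSemigroup, val_eq_addVal, Set.mem_ofPred_eq, RingHom.mem_range,
      exists_exists_eq_and]
  have hfj : Associated (ψ (MvPowerSeries.pderiv k (e.symm none) f))
      (t ^ c * Polynomial.aeval t (Polynomial.derivative (minpoly k⟦X⟧ t))) := by
    refine Associated.trans ?_ hcW
    rw [hψ, hfu, map_mul]
    exact associated_unit_mul_left _ _ (hu.map _)
  have hdiff0 : Polynomial.aeval t (Polynomial.derivative (minpoly k⟦X⟧ t)) ≠ 0 := by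
    intro h0
    rw [h0, mul_zero, associated_zero_iff_eq_zero, hψ] at hfj
    exact hfu0 (hRB (by rw [hfj, map_zero]))
  intro g
  obtain ⟨G, rfl⟩ := Ideal.Quotient.mk_surjective g
  have h1 := associated_bracket_mul e ψ D hchain hψf G
  rw [hψX] at h1
  have h2 : Associated (algebraMap (LocalRing f) (Normalization f)
      (bracket f (Ideal.Quotient.mk (Ideal.span {f}) G))) (t ^ c * D (ψ G)) := by
    refine Associated.of_mul_right ?_ hDX (fun h0 => hdiff0 (hDX.eq_zero_iff.1 h0))
    refine (h1.trans (hfj.mul_right _)).trans (Associated.of_eq ?_)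
    ring
  obtain ⟨v, hv⟩ := h2
  have h3 := congrArg (IsDiscreteValuationRing.addVal (Normalization f)) hv
  rw [AddValuation.map_mul, AddValuation.map_mul,
    IsDiscreteValuationRing.addVal_eq_zero_iff.2 v.isUnit, add_zero,
    IsDiscreteValuationRing.addVal_def (t ^ c) 1 ht c (by simp)] at h3
  rw [h3, hcf, hψ]

end PlaneBranch

theorem corollary2p4 {k : Type*} [Field k] [IsAlgClosed k] (p : ℕ) [CharP k p]
    (f : MvPowerSeries (Fin 2) k) (hf : Irreducible f) (g : PlaneBranch.LocalRing f) :
    (PlaneBranch.conductor f : ℕ∞) + PlaneBranch.val f g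
        ≤ PlaneBranch.val f (PlaneBranch.bracket f g) + 1 ∧
      (g ≠ 0 → ∃ n : ℕ, PlaneBranch.val f g = (n : ℕ∞) ∧
        (PlaneBranch.val f (PlaneBranch.bracket f g) + 1 =
            (PlaneBranch.conductor f : ℕ∞) + PlaneBranch.val f g ↔ ¬ p ∣ n)) := by
  obtain ⟨_, _, _, t, D, hinj, ht, hD, hval⟩ := PlaneBranch.exists_derivation_val_bracket hf
  rw [PlaneBranch.val_eq_addVal, PlaneBranch.val_eq_addVal, hval, add_assoc]
  have hfin : g ≠ 0 → ∃ n : ℕ, IsDiscreteValuationRing.addVal (PlaneBranch.Normalization f)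
      (algebraMap (PlaneBranch.LocalRing f) (PlaneBranch.Normalization f) g) = n := by
    intro hg
    have h0 : algebraMap (PlaneBranch.LocalRing f) (PlaneBranch.Normalization f) g ≠ 0 :=
      (map_ne_zero_iff _ hinj).2 hg
    obtain ⟨n, u, hu⟩ := IsDiscreteValuationRing.eq_unit_mul_pow_irreducible h0 ht
    exact ⟨n, IsDiscreteValuationRing.addVal_def _ u ht n hu⟩
  constructor
  · by_cases hg : g = 0
    · simp [hg]
    · obtain ⟨n, hn⟩ := hfin hg
      rw [hn]
      gcongr
      exact (PlaneBranch.addVal_derivation (k := k) p ht hD hn).1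
  · intro hg
    obtain ⟨n, hn⟩ := hfin hg
    refine ⟨n, hn, ?_⟩
    rw [← (PlaneBranch.addVal_derivation (k := k) p ht hD hn).2, hn]
    exact (ENat.add_right_injective_of_ne_top (ENat.natCast_ne_top _)).eq_iff
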